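/- Let $A$ be a unital semi-simple commutative complex Banach algebra, with space of maximal ideals (characters, i.e. multiplicative functionals) $\mathfrak{M}_A$ and Shilov boundary $\partial A\subseteq \mathfrak{M}_A$ (the smallest closed subset of $\mathfrak{M}_A$ on which the modulus of every Gelfand transform $\hat f$, $f\in A$, attains its maximum over $\mathfrak{M}_A$). For $f \in A$ let $\check f$ be the restriction of $\hat f$ to $\partial A$, and let $\check A$ be the closure of $\{\check f : f\in A\}$ in $C(\partial A)$ with the supremum norm. Let $U$ be an automorphism of $A$, and let $\varphi$ be the homeomorphism $F\mapsto F\circ U$ of $\mathfrak{M}_A$ onto itself, which maps $\partial A$ onto itself. Let $w\in A$, let $T=wU$ be the operator $Tf = w\cdot Uf$ on $A$, and let $\check T$ be the operator on $\check A$ given by $$(\check T g)(t)=\check w(t)\,g(\varphi(t)),\qquad g\in\check A,\ t\in\partial A.$$ Write $\mathbb{T}=\{z\in\mathbb{C}:|z|=1\}$, and let $\sigma$ denote the spectrum of a bounded operator. Assume that 1. $U^n\neq I$ for all integers $n\ge 1$; 2. $\sigma(\check T)\subseteq\mathbb{T}$; 3. $\partial A$ contains no $\varphi$-periodic points, i.e.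 $\varphi^n(t)\ne t$ for all $t\in\partial A$ and $n\geq 1$; 4. every point $s$ of $\partial A$ is a peak point for $\check A$, i.e. there is $g\in\check A$ with $g(s)=1$ and $|g(t)|<1$ for all $t\in\partial A\setminus\{s\}$. Then $\mathbb{T}\subseteq\sigma(T)$. -/

import Mathlib

open Filter Topology WeakDual
set_option linter.unusedSectionVars false

noncomputable section

namespace WeightedAut

variable {A : Type*} [NormedCommRing A] [NormedAlgebra ℂ A] [CompleteSpace A]

variable (A) in
/-- A closed boundary of `A`: a closed set `S` of characters (the maximal ideals of `A`, with the
Gelfand topology) such that the modulus of every Gelfand transform attains on `S` its maximum over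
the whole character space. -/
def IsClosedBoundary (S : Set (characterSpace ℂ A)) : Prop :=
  IsClosed S ∧ ∀ (f : A) (m : characterSpace ℂ A), ∃ t ∈ S, ‖m f‖ ≤ ‖t f‖

variable (A) in
/-- The Shilov boundary `∂A`: the intersection of all closed boundaries. -/
def shilovBoundary : Set (characterSpace ℂ A) :=
  ⋂₀ {S | IsClosedBoundary A S}

theorem isClosed_shilovBoundary : IsClosed (shilovBoundary A) :=
  isClosed_sInter fun _ hS => hS.1

instance : CompactSpace (shilovBoundary A) :=
  isCompact_iff_compactSpace.mp isClosed_shilovBoundary.isCompact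

/-- An automorphism `U` of `A` acts on the space of maximal ideals by `F ↦ F ∘ U`. -/
def dualMap (U : A ≃ₐ[ℂ] A) (F : characterSpace ℂ A) : characterSpace ℂ A :=
  CharacterSpace.equivAlgHom.symm ((CharacterSpace.equivAlgHom F).comp (U : A →ₐ[ℂ] A))

theorem dualMap_apply (U : A ≃ₐ[ℂ] A) (F : characterSpace ℂ A) (f : A) :
    dualMap U F f = F (U f) := rfl

theorem continuous_dualMap (U : A ≃ₐ[ℂ] A) : Continuous (dualMap U) :=
  Continuous.subtype_mk
    (continuous_of_continuous_eval fun a => map_continuous <| gelfandTransform ℂ A (U a)) _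

/-- The homeomorphism `φ` of the space of maximal ideals induced by an automorphism `U`. -/
def phi (U : A ≃ₐ[ℂ] A) : characterSpace ℂ A ≃ₜ characterSpace ℂ A where
  toFun := dualMap U
  invFun := dualMap U.symm
  left_inv F := by
    apply DFunLike.ext
    intro f
    rw [dualMap_apply, dualMap_apply, AlgEquiv.apply_symm_apply]
  right_inv F := by
    apply DFunLike.ext
    intro f
    rw [dualMap_apply, dualMap_apply, AlgEquiv.symm_apply_apply]
  continuous_toFun := continuous_dualMap U
  continuous_invFun := continuous_dualMap U.symm

theorem phi_apply (U : A ≃ₐ[ℂ] A) (F : characterSpace ℂ A) (f : A) :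
    phi U F f = F (U f) := rfl

theorem isClosedBoundary_preimage (U : A ≃ₐ[ℂ] A) {S : Set (characterSpace ℂ A)}
    (hS : IsClosedBoundary A S) : IsClosedBoundary A (phi U ⁻¹' S) := by
  refine ⟨hS.1.preimage (phi U).continuous, fun f m => ?_⟩
  obtain ⟨t, ht, h⟩ := hS.2 (U.symm f) (phi U m)
  refine ⟨(phi U).symm t, ?_, ?_⟩
  · rw [Set.mem_preimage, Homeomorph.apply_symm_apply]
    exact ht
  · rw [phi_apply, AlgEquiv.apply_symm_apply] at h
    exact h

theorem phi_mem_shilovBoundary (U : A ≃ₐ[ℂ] A) :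
    ∀ t ∈ shilovBoundary A, phi U t ∈ shilovBoundary A :=
  fun _ ht S hS => ht (phi U ⁻¹' S) (isClosedBoundary_preimage U hS)

/-- The restriction of `φ` to the Shilov boundary. -/
def phiBoundary (U : A ≃ₐ[ℂ] A) : C(shilovBoundary A, shilovBoundary A) where
  toFun t := ⟨phi U t, phi_mem_shilovBoundary U t t.2⟩
  continuous_toFun :=
    ((phi U).continuous.comp continuous_subtype_val).subtype_mk _

variable (A) in
/-- The map `f ↦ f̌`, the restriction of the Gelfand transform of `f` to the Shilov boundary. -/
def check : A →ₐ[ℂ] C(shilovBoundary A, ℂ) where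
  toFun f := (gelfandTransform ℂ A f).restrict (shilovBoundary A)
  map_one' := by ext; simp
  map_mul' _ _ := by ext; simp
  map_zero' := by ext; simp
  map_add' _ _ := by ext; simp
  commutes' k := by ext t; simp

theorem check_apply (f : A) (t : shilovBoundary A) :
    check A f t = (t : characterSpace ℂ A) f := rfl

variable (A) in
/-- The uniform algebra `Ǎ`: the closure of `{f̌ : f ∈ A}` in `C(∂A)` with the sup norm. -/
def checkAlg : Subalgebra ℂ C(shilovBoundary A, ℂ) :=
  (check A).range.topologicalClosure

/-- The weighted composition operator `g ↦ w̌ · (g ∘ φ)` on the whole of `C(∂A)`. -/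
def compOpC (U : A ≃ₐ[ℂ] A) (w : A) :
    C(shilovBoundary A, ℂ) →L[ℂ] C(shilovBoundary A, ℂ) where
  toFun g := check A w * g.comp (phiBoundary U)
  map_add' _ _ := by ext; simp [mul_add]
  map_smul' _ _ := by ext; simp
  cont := continuous_const.mul (ContinuousMap.continuous_precomp (phiBoundary U))

theorem compOpC_apply (U : A ≃ₐ[ℂ] A) (w : A) (g : C(shilovBoundary A, ℂ))
    (t : shilovBoundary A) :
    compOpC U w g t = check A w t * g (phiBoundary U t) := rfl

theorem compOpC_check (U : A ≃ₐ[ℂ] A) (w f : A) :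
    compOpC U w (check A f) = check A (w * U f) := by
  ext t
  rw [compOpC_apply, map_mul, ContinuousMap.mul_apply]
  rfl

theorem compOpC_mem (U : A ≃ₐ[ℂ] A) (w : A) :
    ∀ g ∈ checkAlg A, compOpC U w g ∈ checkAlg A := by
  intro g hg
  have hmaps : Set.MapsTo (compOpC U w) ((check A).range : Set C(shilovBoundary A, ℂ))
      ((check A).range : Set C(shilovBoundary A, ℂ)) := by
    rintro _ ⟨f, rfl⟩
    exact ⟨w * U f, (compOpC_check U w f).symm⟩
  exact hmaps.closure (compOpC U w).continuous hg

/-- The operator `Ť` on `Ǎ`: `(Ť g)(t) = w̌(t) g(φ(t))`. -/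
def checkOp (U : A ≃ₐ[ℂ] A) (w : A) : checkAlg A →L[ℂ] checkAlg A where
  toFun g := ⟨compOpC U w g, compOpC_mem U w g g.2⟩
  map_add' g h := Subtype.ext (map_add (compOpC U w) (g : C(shilovBoundary A, ℂ)) h)
  map_smul' c g := Subtype.ext (map_smul (compOpC U w) c (g : C(shilovBoundary A, ℂ)))
  cont := ((compOpC U w).continuous.comp continuous_subtype_val).subtype_mk _

theorem checkOp_apply (U : A ≃ₐ[ℂ] A) (w : A) (g : checkAlg A) (t : shilovBoundary A) :
    (checkOp U w g : C(shilovBoundary A, ℂ)) t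
      = check A w t * (g : C(shilovBoundary A, ℂ)) (phiBoundary U t) := rfl

/-- In a semi-simple algebra the characters separate points. -/
theorem eq_zero_of_forall_character (hss : Ring.jacobson A = ⊥) (x : A)
    (hx : ∀ F : characterSpace ℂ A, F x = 0) : x = 0 := by
  have hmem : x ∈ Ideal.jacobson (⊥ : Ideal A) := by
    rw [Ideal.mem_jacobson_bot]
    intro y
    by_contra hy
    obtain ⟨F, hF⟩ := CharacterSpace.exists_apply_eq_zero hy
    rw [map_add, map_mul, hx, zero_mul, map_one, zero_add] at hF
    exact one_ne_zero hF
  rw [Ideal.jacobson_bot, hss] at hmem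
  simpa using hmem

/-- Automorphisms of a semi-simple commutative Banach algebra are automatically continuous. -/
theorem continuous_aut (hss : Ring.jacobson A = ⊥) (U : A ≃ₐ[ℂ] A) : Continuous U := by
  refine (U.toLinearMap).continuous_of_seq_closed_graph fun u x y hu hv => ?_
  refine sub_eq_zero.mp (eq_zero_of_forall_character hss _ fun F => ?_)
  have h1 : Tendsto (fun n => F (U (u n))) atTop (𝓝 (F y)) :=
    ((map_continuous F).tendsto y).comp hv
  have h2 : Tendsto (fun n => F (U (u n))) atTop (𝓝 (F (U x))) :=
    ((map_continuous (dualMap U F)).tendsto x).comp hu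
  rw [map_sub, tendsto_nhds_unique h1 h2]
  exact sub_self _

/-- The weighted automorphism `T = wU`, `T f = w · U f`, as a bounded operator on `A`. -/
def weightedOp (hss : Ring.jacobson A = ⊥) (U : A ≃ₐ[ℂ] A) (w : A) : A →L[ℂ] A where
  toFun f := w * U f
  map_add' f g := by rw [map_add, mul_add]
  map_smul' c f := by rw [map_smul, mul_smul_comm, RingHom.id_apply]
  cont := continuous_const.mul (continuous_aut hss U)

end WeightedAut

/-- `s` is a peak point for the algebra `B` of continuous functions on `X`. -/
def IsPeakPoint {X : Type*} [TopologicalSpace X] (B : Subalgebra ℂ C(X, ℂ)) (s : X) : Prop :=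
  ∃ g ∈ B, g s = 1 ∧ ∀ t, t ≠ s → ‖g t‖ < 1

end

open Filter Topology WeakDual

noncomputable section

/-! Suppose some λ on the unit circle lies outside σ(T). Then the resolvent of T is holomorphic near
λ, and evaluating it at a suitable point t of ∂A produces holomorphic functions with an impossible
limit.

Since σ(Ť) lies on the circle, Ť is invertible and the powers Ťⁿ, n ∈ ℤ, grow subexponentially.
Their weights Ťⁿ1 form a cocycle over φ, and a near-maximum argument with compactness gives t at
which every weight has modulus at most 1 (`exists_forall_norm_cocycle_le_one`). The functionals
Φₙ(h) = (Ťⁿ ȟ)(t) are then bounded by |ȟ(φⁿ t)|, and Φₙ(Th) = Φₙ₊₁(h).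

If zh − Th = f, then aₙ = Φₙ(h) is a bounded solution of z aₙ − aₙ₊₁ = cₙ with cₙ = Φₙ(f). Hence
z·ȟ(t) is the sum of z⁻ⁿcₙ over n ≥ 0 when |z| > 1, and minus the sum of zⁿc₋ₙ over n ≥ 1 when |z| <
1. Powers of a peak function give a bounded sequence f_k in A with f̌_k tending pointwise to the
indicator of t. As t is not periodic, cₙ tends to 1 for n = 0 and to 0 otherwise, so the functions
z·(R(z)f_k)(t) tend to 1 outside the circle and to 0 inside.

With z = λeᵘ these functions are holomorphic on a square about 0 and uniformly O(1/|Re u|). Cauchy's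
theorem on the square, with a weight killing the singularity of the bound, forbids such a jump
(`not_tendsto_indicator_re_pos`). -/

/-! ### Bounded solutions of z aₙ − aₙ₊₁ = cₙ. -/

theorem hasSum_forward_of_recurrence {a c : ℤ → ℂ} {z : ℂ} {B : ℝ} (hz : 1 < ‖z‖)
    (ha : ∀ n, ‖a n‖ ≤ B) {M : ℝ} (hc : ∀ n, ‖c n‖ ≤ M) (h : ∀ n, z * a n - a (n + 1) = c n) :
    HasSum (fun n : ℕ => z⁻¹ ^ n * c n) (z * a 0) := by
  have hz0 : z ≠ 0 := fun h0 => by simp [h0] at hz; linarith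
  have hlt : ‖z⁻¹‖ < 1 := by rw [norm_inv]; exact inv_lt_one_of_one_lt₀ hz
  have hs : Summable (fun n : ℕ => z⁻¹ ^ n * c n) := by
    refine Summable.of_norm_bounded
      ((summable_geometric_of_lt_one (norm_nonneg _) hlt).mul_right M) fun n => ?_
    rw [norm_mul, norm_pow]
    exact mul_le_mul_of_nonneg_left (hc n) (by positivity)
  rw [hs.hasSum_iff_tendsto_nat]
  -- The sum telescopes; boundedness of a makes the remainder vanish.
  have hpart : ∀ N : ℕ, ∑ n ∈ Finset.range N, z⁻¹ ^ n * c n = z * a 0 - z⁻¹ ^ N * (z * a N) := by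
    intro N
    induction N with
    | zero => simp
    | succ k ih =>
      rw [Finset.sum_range_succ, ih, ← h k, pow_succ]
      push_cast
      field_simp
      ring
  simp_rw [hpart]
  have hzero : Tendsto (fun N : ℕ => z⁻¹ ^ N * (z * a N)) atTop (𝓝 0) := by
    refine squeeze_zero_norm (a := fun N : ℕ => ‖z⁻¹‖ ^ N * (‖z‖ * B)) (fun N => ?_) ?_
    · rw [norm_mul, norm_pow, norm_mul]
      gcongr
      exact ha _
    · simpa using (tendsto_pow_atTop_nhds_zero_of_lt_one (norm_nonneg _) hlt).mul_const (‖z‖ * B)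
  simpa using tendsto_const_nhds.sub hzero

/-- Iterating a₀ = z a₋₁ − c₋₁ backwards involves negative indices only. The absence of c₀ here,
against its presence in the forward series, is the source of the jump across the circle. -/
theorem hasSum_backward_of_recurrence {a c : ℤ → ℂ} {z : ℂ} {B : ℝ} (hz : ‖z‖ < 1)
    (ha : ∀ n, ‖a n‖ ≤ B) {M : ℝ} (hc : ∀ n, ‖c n‖ ≤ M) (h : ∀ n, z * a n - a (n + 1) = c n) :
    HasSum (fun n : ℕ => -(z ^ (n + 1) * c (-(n + 1)))) (z * a 0) := by
  have hs : Summable (fun n : ℕ => -(z ^ (n + 1) * c (-(n + 1)))) := by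
    refine Summable.of_norm_bounded
      (((summable_geometric_of_lt_one (norm_nonneg _) hz).mul_left ‖z‖).mul_right M) fun n => ?_
    rw [norm_neg, norm_mul, norm_pow, pow_succ']
    exact mul_le_mul_of_nonneg_left (hc _) (by positivity)
  rw [hs.hasSum_iff_tendsto_nat]
  have hpart : ∀ N : ℕ, ∑ n ∈ Finset.range N, -(z ^ (n + 1) * c (-(n + 1)))
      = z * a 0 - z ^ (N + 1) * a (-N) := by
    intro N
    induction N with
    | zero => simp
    | succ k ih =>
      rw [Finset.sum_range_succ, ih, ← h]
      push_cast
      rw [show (-((k : ℤ) + 1) + 1) = -k by ring]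
      ring
  simp_rw [hpart]
  have hzero : Tendsto (fun N : ℕ => z ^ (N + 1) * a (-N)) atTop (𝓝 0) := by
    refine squeeze_zero_norm (a := fun N : ℕ => ‖z‖ ^ (N + 1) * B) (fun N => ?_) ?_
    · rw [norm_mul, norm_pow]
      gcongr
      exact ha _
    · simpa using ((tendsto_add_atTop_iff_nat 1).mpr
        (tendsto_pow_atTop_nhds_zero_of_lt_one (norm_nonneg _) hz)).mul_const B
  simpa using tendsto_const_nhds.sub hzero

theorem norm_le_of_hasSum_forward {c : ℤ → ℂ} {z s : ℂ} {M : ℝ} (hz : 1 < ‖z‖)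
    (hc : ∀ n, ‖c n‖ ≤ M) (h : HasSum (fun n : ℕ => z⁻¹ ^ n * c n) s) :
    ‖s‖ ≤ (1 - ‖z‖⁻¹)⁻¹ * M := by
  have hlt : ‖z‖⁻¹ < 1 := inv_lt_one_of_one_lt₀ hz
  rw [← h.tsum_eq]
  refine tsum_of_norm_bounded
    ((hasSum_geometric_of_lt_one (by positivity) hlt).mul_right M) fun n => ?_
  rw [norm_mul, norm_pow, norm_inv]
  exact mul_le_mul_of_nonneg_left (hc n) (by positivity)

theorem norm_le_of_hasSum_backward {c : ℤ → ℂ} {z s : ℂ} {M : ℝ} (hz : ‖z‖ < 1)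
    (hc : ∀ n, ‖c n‖ ≤ M)
    (h : HasSum (fun n : ℕ => -(z ^ (n + 1) * c (-(n + 1)))) s) :
    ‖s‖ ≤ ‖z‖ * (1 - ‖z‖)⁻¹ * M := by
  rw [← h.tsum_eq]
  refine tsum_of_norm_bounded
    (((hasSum_geometric_of_lt_one (norm_nonneg _) hz).mul_left ‖z‖).mul_right M) fun n => ?_
  rw [norm_neg, norm_mul, norm_pow, pow_succ']
  exact mul_le_mul_of_nonneg_left (hc _) (by positivity)

/-- Dominated convergence against a geometric series; only the term n = 0 survives. -/
theorem tendsto_one_of_hasSum_forward {c : ℕ → ℤ → ℂ} {z : ℂ} {s : ℕ → ℂ} {M : ℝ} (hz : 1 < ‖z‖)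
    (hc : ∀ k n, ‖c k n‖ ≤ M) (h : ∀ k, HasSum (fun n : ℕ => z⁻¹ ^ n * c k n) (s k))
    (hlim : ∀ n, Tendsto (fun k => c k n) atTop (𝓝 (if n = 0 then 1 else 0))) :
    Tendsto s atTop (𝓝 1) := by
  have hlt : ‖z‖⁻¹ < 1 := inv_lt_one_of_one_lt₀ hz
  have key := tendsto_tsum_of_dominated_convergence (𝓕 := atTop)
    (f := fun k (n : ℕ) => z⁻¹ ^ n * c k n) (g := fun n : ℕ => if n = 0 then 1 else 0)
    (bound := fun n => ‖z‖⁻¹ ^ n * M)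
    ((summable_geometric_of_lt_one (by positivity) hlt).mul_right M) (fun n => by
      have := (hlim n).const_mul (z⁻¹ ^ n)
      rcases eq_or_ne n 0 with rfl | hn
      · simpa using this
      · simpa [hn] using this)
    (Eventually.of_forall fun k n => by
      rw [norm_mul, norm_pow, norm_inv]
      exact mul_le_mul_of_nonneg_left (hc k n) (by positivity))
  simp_rw [fun k => (h k).tsum_eq] at key
  simpa using key

theorem tendsto_zero_of_hasSum_backward {c : ℕ → ℤ → ℂ} {z : ℂ} {s : ℕ → ℂ} {M : ℝ}
    (hz : ‖z‖ < 1) (hc : ∀ k n, ‖c k n‖ ≤ M)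
    (h : ∀ k, HasSum (fun n : ℕ => -(z ^ (n + 1) * c k (-(n + 1)))) (s k))
    (hlim : ∀ n, Tendsto (fun k => c k n) atTop (𝓝 (if n = 0 then 1 else 0))) :
    Tendsto s atTop (𝓝 0) := by
  have key := tendsto_tsum_of_dominated_convergence (𝓕 := atTop)
    (f := fun k (n : ℕ) => -(z ^ (n + 1) * c k (-(n + 1)))) (g := fun _ : ℕ => 0)
    (bound := fun n => ‖z‖ * ‖z‖ ^ n * M)
    (((summable_geometric_of_lt_one (norm_nonneg _) hz).mul_left ‖z‖).mul_right M) (fun n => by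
      have := ((hlim (-(n + 1))).const_mul (z ^ (n + 1))).neg
      rw [if_neg (by omega)] at this
      simpa using this)
    (Eventually.of_forall fun k n => by
      rw [norm_neg, norm_mul, norm_pow, pow_succ']
      exact mul_le_mul_of_nonneg_left (hc k _) (by positivity))
  simp_rw [fun k => (h k).tsum_eq] at key
  simpa using key

/-! ### A contour integral obstruction. -/

open MeasureTheory intervalIntegral Complex in
/-- Holomorphic functions on a square centred at the origin, bounded by a multiple of `1 / |re u|`,
cannot converge to the indicator function of the right half-plane. -/
theorem not_tendsto_indicator_re_pos {d M : ℝ} (hd : 0 < d) (G : ℕ → ℂ → ℂ)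
    (hG : ∀ k, DifferentiableOn ℂ (G k) (Set.Icc (-d) d ×ℂ Set.Icc (-d) d))
    (hM : ∀ k, ∀ u ∈ Set.Icc (-d) d ×ℂ Set.Icc (-d) d, u.re ≠ 0 → ‖G k u‖ * |u.re| ≤ M)
    (hpos : ∀ u ∈ Set.Icc (-d) d ×ℂ Set.Icc (-d) d, 0 < u.re →
      Tendsto (fun k => G k u) atTop (𝓝 1))
    (hneg : ∀ u ∈ Set.Icc (-d) d ×ℂ Set.Icc (-d) d, u.re < 0 →
      Tendsto (fun k => G k u) atTop (𝓝 0)) : False := by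
  set Q : Set ℂ := Set.Icc (-d) d ×ℂ Set.Icc (-d) d with hQ
  have hM0 : 0 ≤ M := (by positivity : 0 ≤ ‖G 0 (d : ℂ)‖ * |(d : ℂ).re|).trans
    (hM 0 d (by simp [hQ, mem_reProdIm, hd.le]) (by simp [hd.ne']))
  -- The weight vanishes at ±id, exactly where the boundary of the square meets the imaginary axis,
  -- and so absorbs the factor 1 / |re u| there.
  let H : ℕ → ℂ → ℂ := fun k u => (u ^ 2 + d ^ 2) * G k u
  let L : ℂ → ℂ := fun u => if 0 < u.re then u ^ 2 + d ^ 2 else 0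
  have hHd : ∀ k, DifferentiableOn ℂ (H k) Q := fun k =>
    DifferentiableOn.mul (by fun_prop) (hG k)
  have hrect : ∀ k, (∫ x : ℝ in (-d)..d, H k (x + (-d : ℝ) * I))
      - (∫ x : ℝ in (-d)..d, H k (x + d * I)) + I • (∫ y : ℝ in (-d)..d, H k (d + y * I))
      - I • (∫ y : ℝ in (-d)..d, H k ((-d : ℝ) + y * I)) = 0 := by
    intro k
    have := integral_boundary_rect_eq_zero_of_differentiableOn (H k) (⟨-d, -d⟩ : ℂ) (⟨d, d⟩ : ℂ) (by
      simpa [Set.uIcc_of_le (show -d ≤ d by linarith)] using hHd k)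
    simpa using this
  have hlimpt : ∀ u ∈ Q, (u.re = 0 → u ^ 2 + d ^ 2 = 0) →
      Tendsto (fun k => H k u) atTop (𝓝 (L u)) := by
    intro u hu h0
    rcases lt_trichotomy u.re 0 with h | h | h
    · simpa [L, h.not_gt] using (hneg u hu h).const_mul (u ^ 2 + (d : ℂ) ^ 2)
    · simp [H, L, h0 h, h]
    · simpa [L, h] using (hpos u hu h).const_mul (u ^ 2 + (d : ℂ) ^ 2)
  have hconv : ∀ γ : ℝ → ℂ, Continuous γ → (∀ x ∈ Set.Icc (-d) d, γ x ∈ Q) →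
      (∀ x ∈ Set.Icc (-d) d, ‖γ x ^ 2 + d ^ 2‖ ≤ 5 * d * |(γ x).re|) →
      Tendsto (fun k => ∫ x : ℝ in (-d)..d, H k (γ x)) atTop
        (𝓝 (∫ x : ℝ in (-d)..d, L (γ x))) := by
    intro γ hγ hγQ hγb
    have hsub : Set.uIoc (-d) d ⊆ Set.Icc (-d) d := by
      rw [Set.uIoc_of_le (by linarith)]; exact Set.Ioc_subset_Icc_self
    refine tendsto_integral_filter_of_dominated_convergence (fun _ => 5 * d * M) ?_ ?_ ?_ ?_
    · refine Eventually.of_forall fun k => ?_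
      refine (ContinuousOn.aestronglyMeasurable ?_ measurableSet_uIoc)
      exact ((hHd k).continuousOn.comp hγ.continuousOn hγQ).mono hsub
    · refine Eventually.of_forall fun k => Eventually.of_forall fun x hx => ?_
      have hx := hsub hx
      rw [norm_mul]
      rcases eq_or_ne (γ x).re 0 with h | h
      · have := hγb x hx
        rw [h, abs_zero, mul_zero] at this
        rw [le_antisymm this (norm_nonneg _), zero_mul]
        positivity
      · calc _ ≤ 5 * d * |(γ x).re| * ‖G k (γ x)‖ := by gcongr; exact hγb x hx
          _ = 5 * d * (‖G k (γ x)‖ * |(γ x).re|) := by ring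
          _ ≤ _ := by gcongr; exact hM k _ (hγQ x hx) h
    · exact intervalIntegrable_const
    · refine Eventually.of_forall fun x hx => hlimpt _ (hγQ x (hsub hx)) fun h => ?_
      have := hγb x (hsub hx)
      rw [h, abs_zero, mul_zero] at this
      exact norm_le_zero_iff.mp this
  have hhor : ∀ e : ℝ, |e| = d → ∀ x ∈ Set.Icc (-d) d,
      ‖((x : ℂ) + e * I) ^ 2 + (d : ℂ) ^ 2‖ ≤ 5 * d * |((x : ℂ) + e * I).re| := by
    intro e he x hx
    have h2 : (d : ℂ) ^ 2 = (e : ℂ) ^ 2 := by rw [← he]; norm_cast; exact sq_abs e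
    have : ((x : ℂ) + e * I) ^ 2 + (d : ℂ) ^ 2 = x * (x + 2 * e * I) := by
      rw [h2]; linear_combination (e : ℂ) ^ 2 * I_sq
    rw [this, norm_mul]
    have h3 : ‖(x : ℂ) + 2 * e * I‖ ≤ 4 * d := by
      refine (norm_add_le _ _).trans ?_
      simp only [norm_mul, norm_real, Real.norm_eq_abs, he, norm_I, norm_ofNat]
      have := abs_le.mpr hx
      linarith
    simp only [add_re, ofReal_re, re_ofReal_mul, I_re, mul_zero, add_zero, norm_real,
      Real.norm_eq_abs]
    nlinarith [abs_nonneg x]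
  have hver : ∀ e : ℝ, |e| = d → ∀ y ∈ Set.Icc (-d) d,
      ‖((e : ℂ) + y * I) ^ 2 + (d : ℂ) ^ 2‖ ≤ 5 * d * |((e : ℂ) + y * I).re| := by
    intro e he y hy
    have hy' := abs_le.mpr hy
    have h2 : (d : ℂ) ^ 2 = (e : ℂ) ^ 2 := by rw [← he]; norm_cast; exact sq_abs e
    have : ((e : ℂ) + y * I) ^ 2 + (d : ℂ) ^ 2 = 2 * e * e + 2 * e * y * I - y * y := by
      rw [h2]; linear_combination (y : ℂ) ^ 2 * I_sq
    rw [this]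
    have h5 : ‖2 * (e : ℂ) * e + 2 * e * y * I - y * y‖ ≤ 2 * d * d + 2 * d * |y| + |y| * |y| := by
      refine (norm_sub_le _ _).trans ?_
      refine (add_le_add_left (norm_add_le _ _) _).trans ?_
      simp [he]
    refine h5.trans ?_
    simp only [add_re, ofReal_re, re_ofReal_mul, I_re, mul_zero, add_zero, he]
    nlinarith [abs_nonneg y]
  -- The positive part of x turns the two cases into one continuous formula, which can be integrated
  -- after splitting at 0.
  have hL : ∀ x e : ℝ, |e| = d →
      L (x + e * I) = ((max x 0 : ℝ) : ℂ) ^ 2 + 2 * e * I * ((max x 0 : ℝ) : ℂ) := by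
    intro x e he
    have h2 : (d : ℂ) ^ 2 = (e : ℂ) ^ 2 := by rw [← he]; norm_cast; exact sq_abs e
    simp only [L, add_re, ofReal_re, re_ofReal_mul, I_re, mul_zero, add_zero]
    split_ifs with hx
    · rw [max_eq_left hx.le, h2]
      linear_combination (e : ℂ) ^ 2 * I_sq
    · simp [max_eq_right (not_lt.mp hx)]
  have hLint : ∀ e : ℝ, |e| = d →
      ∫ x : ℝ in (-d)..d, L (x + e * I) = (d : ℂ) ^ 3 / 3 + e * d ^ 2 * I := by
    intro e he
    simp_rw [fun x => hL x e he]
    have hcont : Continuous fun x : ℝ =>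
        ((max x 0 : ℝ) : ℂ) ^ 2 + 2 * e * I * ((max x 0 : ℝ) : ℂ) := by fun_prop
    rw [← integral_add_adjacent_intervals (hcont.intervalIntegrable (-d) 0)
      (hcont.intervalIntegrable 0 d)]
    have h1 : ∫ x : ℝ in (-d)..0, (((max x 0 : ℝ) : ℂ) ^ 2 + 2 * e * I * ((max x 0 : ℝ) : ℂ))
        = ∫ x : ℝ in (-d)..0, (0 : ℂ) := by
      refine integral_congr fun x hx => ?_
      rw [Set.uIcc_of_le (by linarith)] at hx
      simp [max_eq_right hx.2]
    have h2 : ∫ x : ℝ in (0 : ℝ)..d, (((max x 0 : ℝ) : ℂ) ^ 2 + 2 * e * I * ((max x 0 : ℝ) : ℂ))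
        = ∫ x : ℝ in (0 : ℝ)..d, ((x : ℂ) ^ 2 + 2 * e * I * (x : ℂ)) := by
      refine integral_congr fun x hx => ?_
      rw [Set.uIcc_of_le hd.le] at hx
      simp [max_eq_left hx.1]
    rw [h1, h2, intervalIntegral.integral_zero, zero_add, intervalIntegral.integral_add,
      intervalIntegral.integral_const_mul]
    · have e1 : ∫ x : ℝ in (0 : ℝ)..d, (x : ℂ) ^ 2 = (d : ℂ) ^ 3 / 3 := by
        have h3 : ∀ x : ℝ, (x : ℂ) ^ 2 = ((x ^ 2 : ℝ) : ℂ) := fun x => by push_cast; rfl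
        simp_rw [h3]
        rw [intervalIntegral.integral_ofReal, integral_pow]
        push_cast
        ring
      have e2 : ∫ x : ℝ in (0 : ℝ)..d, (x : ℂ) = (d : ℂ) ^ 2 / 2 := by
        rw [intervalIntegral.integral_ofReal, integral_id]
        push_cast
        ring
      rw [e1, e2]
      ring
    · exact Continuous.intervalIntegrable (by fun_prop) _ _
    · exact Continuous.intervalIntegrable (by fun_prop) _ _
  have hL3 : ∫ y : ℝ in (-d)..d, L (d + y * I) = 10 / 3 * (d : ℂ) ^ 3 := by
    have : ∀ y : ℝ, L (d + y * I) = 2 * (d : ℂ) ^ 2 + 2 * d * I * y - (y : ℂ) ^ 2 := by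
      intro y
      simp only [L, add_re, ofReal_re, re_ofReal_mul, I_re, mul_zero, add_zero, hd, if_true]
      linear_combination (y : ℂ) ^ 2 * I_sq
    simp_rw [this]
    have hderiv : ∀ y : ℝ, HasDerivAt
        (fun y : ℝ => 2 * (d : ℂ) ^ 2 * y + d * I * (y : ℂ) ^ 2 - (y : ℂ) ^ 3 / 3)
        (2 * (d : ℂ) ^ 2 + 2 * d * I * y - (y : ℂ) ^ 2) y := by
      intro y
      have hy : HasDerivAt (fun y : ℝ => (y : ℂ)) 1 y := ofRealCLM.hasDerivAt
      refine (((hy.const_mul (2 * (d : ℂ) ^ 2)).add ((hy.pow 2).const_mul (d * I))).sub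
        ((hy.pow 3).div_const 3)).congr_deriv ?_
      push_cast
      ring
    rw [integral_eq_sub_of_hasDerivAt (fun y _ => hderiv y)
      (Continuous.intervalIntegrable (by fun_prop) _ _)]
    push_cast
    ring
  have hL4 : ∫ y : ℝ in (-d)..d, L ((-d : ℝ) + y * I) = 0 := by
    have : ∀ y : ℝ, L ((-d : ℝ) + y * I) = 0 := by
      intro y
      simp [L, hd.le]
    simp_rw [this]
    simp
  have hmem : ∀ x y : ℝ, x ∈ Set.Icc (-d) d → y ∈ Set.Icc (-d) d → (x : ℂ) + y * I ∈ Q := by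
    intro x y hx hy
    simpa [hQ, mem_reProdIm] using And.intro hx hy
  have hdm : d ∈ Set.Icc (-d) d := ⟨by linarith, le_rfl⟩
  have hdm' : -d ∈ Set.Icc (-d) d := ⟨le_rfl, by linarith⟩
  have had : |d| = d := abs_of_pos hd
  have had' : |-d| = d := by rw [abs_neg, had]
  have t1 := hconv (fun x => x + (-d : ℝ) * I) (by fun_prop) (fun x hx => hmem x _ hx hdm')
    (hhor _ had')
  have t2 := hconv (fun x => x + d * I) (by fun_prop) (fun x hx => hmem x _ hx hdm) (hhor _ had)
  have t3 := hconv (fun y => d + y * I) (by fun_prop) (fun x hx => hmem _ _ hdm hx) (hver _ had)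
  have t4 := hconv (fun y => (-d : ℝ) + y * I) (by fun_prop) (fun x hx => hmem _ _ hdm' hx)
    (hver _ had')
  have tt := ((t1.sub t2).add (t3.const_smul I)).sub (t4.const_smul I)
  simp only [hrect, hLint _ had, hLint _ had', hL3, hL4] at tt
  have h0 := tendsto_nhds_unique tt tendsto_const_nhds
  -- The limit is the integral of u² + d² around the right half of the square without its side on
  -- the imaginary axis. By Cauchy it is the integral of i(d² − y²) over [−d, d], which is nonzero.
  have h1 : 4 / 3 * I * (d : ℂ) ^ 3 = 0 := by
    rw [← h0]; push_cast; simp only [smul_eq_mul]; ring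
  simp [hd.ne'] at h1

/-! ### Shilov's theorem, needed for ∂A to be nonempty. -/

namespace WeightedAut
variable {A : Type*} [NormedCommRing A] [NormedAlgebra ℂ A] [CompleteSpace A]

theorem isClosedBoundary_univ : IsClosedBoundary A Set.univ :=
  ⟨isClosed_univ, fun _ m => ⟨m, trivial, le_rfl⟩⟩

theorem continuous_eval_character (f : A) : Continuous fun m : characterSpace ℂ A => m f :=
  map_continuous (gelfandTransform ℂ A f)

/-- For fixed f and m the points of S where |f̂| is at least |m f| form nested nonempty compact sets
as S runs through the chain. -/
theorem isClosedBoundary_sInter_chain {c : Set (Set (characterSpace ℂ A))}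
    (hc : ∀ S ∈ c, IsClosedBoundary A S) (hchain : IsChain (· ⊆ ·) c) (hne : c.Nonempty) :
    IsClosedBoundary A (⋂₀ c) := by
  refine ⟨isClosed_sInter fun S hS => (hc S hS).1, fun f m => ?_⟩
  have : Nonempty c := hne.to_subtype
  have hcl : ∀ S : c, IsClosed ((S : Set (characterSpace ℂ A)) ∩ {t | ‖m f‖ ≤ ‖t f‖}) := fun S =>
    (hc S S.2).1.inter (isClosed_le continuous_const (continuous_eval_character f).norm)
  obtain ⟨t, ht⟩ := IsCompact.nonempty_iInter_of_directed_nonempty_isCompact_isClosed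
    (fun S : c => (S : Set (characterSpace ℂ A)) ∩ {t | ‖m f‖ ≤ ‖t f‖})
    (fun S T => by
      rcases hchain.total S.2 T.2 with h | h
      · exact ⟨S, subset_rfl, Set.inter_subset_inter_left _ h⟩
      · exact ⟨T, Set.inter_subset_inter_left _ h, subset_rfl⟩)
    (fun S => by
      obtain ⟨t, ht, h⟩ := (hc S S.2).2 f m
      exact ⟨t, ht, h⟩)
    (fun S => (hcl S).isCompact) hcl
  rw [Set.mem_iInter] at ht
  exact ⟨t, fun S hS => (ht ⟨S, hS⟩).1, (ht this.some).2⟩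

theorem exists_minimal_isClosedBoundary :
    ∃ S : Set (characterSpace ℂ A), Minimal (IsClosedBoundary A) S := by
  obtain ⟨S, -, hS⟩ := zorn_superset_nonempty {S | IsClosedBoundary A S} (fun c hc hch hne =>
    ⟨⋂₀ c, isClosedBoundary_sInter_chain hc hch hne, fun S hS => Set.sInter_subset_of_mem hS⟩)
    Set.univ isClosedBoundary_univ
  exact ⟨S, hS⟩

/-- Finitely many Gelfand transforms vanishing at a point determine a basic neighbourhood of it. -/
theorem exists_finset_nhds_character {V : Set (characterSpace ℂ A)} {t : characterSpace ℂ A}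
    (hV : V ∈ 𝓝 t) : ∃ (s : Finset A) (ε : ℝ), 0 < ε ∧ (∀ a ∈ s, t a = 0) ∧
      ∀ m : characterSpace ℂ A, (∀ a ∈ s, ‖m a‖ < ε) → m ∈ V := by
  have hind : Topology.IsInducing (fun (m : characterSpace ℂ A) (a : A) => m a) :=
    (WeakBilin.isEmbedding (B := topDualPairing ℂ A)
      ContinuousLinearMap.coe_injective).isInducing.comp Topology.IsInducing.subtypeVal
  rw [hind.nhds_eq_comap, Filter.mem_comap] at hV
  obtain ⟨W, hW, hWV⟩ := hV
  rw [nhds_pi, Filter.mem_pi] at hW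
  obtain ⟨I, hI, u, hu, huW⟩ := hW
  have hε : ∀ a, ∃ ε > 0, Metric.ball (t a) ε ⊆ u a := fun a => Metric.mem_nhds_iff.mp (hu a)
  choose ε hε hεu using hε
  classical
  obtain ⟨e, he, hle⟩ : ∃ e : ℝ, 0 < e ∧ ∀ a ∈ I, e ≤ ε a := by
    rcases I.eq_empty_or_nonempty with rfl | hne
    · exact ⟨1, one_pos, by simp⟩
    · obtain ⟨a, -, hmin⟩ := Set.exists_min_image I ε hI hne
      exact ⟨ε a, hε a, hmin⟩
  refine ⟨hI.toFinset.image (fun a => a - algebraMap ℂ A (t a)), e, he, ?_, fun m hm => ?_⟩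
  · intro b hb
    obtain ⟨a, -, rfl⟩ := Finset.mem_image.mp hb
    rw [map_sub, AlgHomClass.commutes, Algebra.algebraMap_self, RingHom.id_apply, sub_self]
  · refine hWV (huW fun a ha => hεu a ?_)
    have := hm _ (Finset.mem_image_of_mem _ (hI.mem_toFinset.mpr ha))
    rw [map_sub, AlgHomClass.commutes, Algebra.algebraMap_self, RingHom.id_apply] at this
    rw [Metric.mem_ball, dist_eq_norm]
    exact this.trans_le (hle a ha)

/-- If E misses a basic neighbourhood V of some t in S, minimality gives f whose transform stays
strictly below its maximum R on S \ V. Multiplying by a high power of f makes the part of S outside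
V negligible, which forces a point e of E with |e f| = R into V. -/
theorem subset_of_minimal_isClosedBoundary {S E : Set (characterSpace ℂ A)}
    (hS : Minimal (IsClosedBoundary A) S) (hE : IsClosedBoundary A E) : S ⊆ E := by
  intro t ht
  by_contra htE
  obtain ⟨s, ε, hε, hs0, hsE⟩ := exists_finset_nhds_character (hE.1.isOpen_compl.mem_nhds htE)
  set V : Set (characterSpace ℂ A) := {m | ∀ a ∈ s, ‖m a‖ < ε} with hVdef
  have hVo : IsOpen V := by
    have : V = ⋂ a ∈ s, {m : characterSpace ℂ A | ‖m a‖ < ε} := by ext; simp [hVdef]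
    rw [this]
    exact isOpen_biInter_finset fun a _ =>
      isOpen_lt (continuous_eval_character a).norm continuous_const
  have hcl : IsClosed (S \ V) := hS.1.1.sdiff hVo
  have hnot : ¬ IsClosedBoundary A (S \ V) := fun h =>
    (hS.2 h Set.sdiff_subset ht).2 fun a ha => by rw [hs0 a ha, norm_zero]; exact hε
  have hex : ∃ (f : A) (m : characterSpace ℂ A), ∀ x ∈ S \ V, ‖x f‖ < ‖m f‖ := by
    by_contra! hcon
    exact hnot ⟨hcl, hcon⟩
  obtain ⟨f, m, hfm⟩ := hex
  obtain ⟨m₀, -, hm₀⟩ := (isCompact_univ (X := characterSpace ℂ A)).exists_isMaxOn ⟨m, trivial⟩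
    (continuous_eval_character f).norm.continuousOn
  have hmax : ∀ x : characterSpace ℂ A, ‖x f‖ ≤ ‖m₀ f‖ := fun x => hm₀ trivial
  set R := ‖m₀ f‖ with hR
  have hsmall : ∀ x ∈ S \ V, ‖x f‖ < R := fun x hx => (hfm x hx).trans_le (hmax m)
  obtain ⟨e, heE, heR⟩ := hE.2 f m₀
  have heR : ‖e f‖ = R := le_antisymm (hmax e) heR
  have hR0 : 0 ≤ R := norm_nonneg _
  suffices hk : ∀ a ∈ s, ‖e a‖ < ε from hsE e hk heE
  intro a ha
  -- If R = 0, the strict inequality on S \ V leaves S inside V, and no power of f is needed.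
  rcases hR0.eq_or_lt with h0 | hRpos
  · have hSV : S ⊆ V := fun x hx => by
      by_contra hxV
      exact absurd (hsmall x ⟨hx, hxV⟩) (by rw [← h0]; exact not_lt.mpr (norm_nonneg _))
    obtain ⟨x, hx, hle⟩ := hS.1.2 a e
    exact hle.trans_lt (hSV hx a ha)
  obtain ⟨q, hq0, hq1, hq⟩ : ∃ q : ℝ, 0 ≤ q ∧ q < 1 ∧ ∀ x ∈ S \ V, ‖x f‖ ≤ q * R := by
    rcases (S \ V).eq_empty_or_nonempty with hemp | hne
    · exact ⟨0, le_rfl, one_pos, by simp [hemp]⟩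
    · obtain ⟨x₀, hx₀, hx₀max⟩ := hcl.isCompact.exists_isMaxOn hne
        (continuous_eval_character f).norm.continuousOn
      refine ⟨‖x₀ f‖ / R, by positivity, (div_lt_one hRpos).mpr (hsmall _ hx₀), fun x hx => ?_⟩
      rw [div_mul_cancel₀ _ hRpos.ne']
      exact hx₀max hx
  obtain ⟨k, hk⟩ : ∃ k : ℕ, q ^ k * ‖gelfandTransform ℂ A a‖ < ε := by
    have := (tendsto_pow_atTop_nhds_zero_of_lt_one hq0 hq1).mul_const ‖gelfandTransform ℂ A a‖
    rw [zero_mul] at this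
    exact (this.eventually_lt_const hε).exists
  obtain ⟨x, hx, hle⟩ := hS.1.2 (f ^ k * a) e
  rw [map_mul, map_mul, map_pow, map_pow, norm_mul, norm_mul, norm_pow, norm_pow, heR] at hle
  have hRk : 0 < R ^ k := pow_pos hRpos k
  by_cases hxV : x ∈ V
  · have : R ^ k * ‖e a‖ ≤ R ^ k * ‖x a‖ := hle.trans (by gcongr; exact hmax x)
    exact (le_of_mul_le_mul_left this hRk).trans_lt (hxV a ha)
  · have hxa : ‖x a‖ ≤ ‖gelfandTransform ℂ A a‖ := (gelfandTransform ℂ A a).norm_coe_le_norm x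
    have : R ^ k * ‖e a‖ ≤ R ^ k * (q ^ k * ‖gelfandTransform ℂ A a‖) :=
      hle.trans (by
        calc _ ≤ (q * R) ^ k * ‖gelfandTransform ℂ A a‖ := by gcongr; exact hq x ⟨hx, hxV⟩
          _ = _ := by rw [mul_pow]; ring)
    exact (le_of_mul_le_mul_left this hRk).trans_lt hk

/-- Shilov's theorem: the intersection of all closed boundaries is a closed boundary. -/
theorem isClosedBoundary_shilovBoundary : IsClosedBoundary A (shilovBoundary A) := by
  obtain ⟨S, hS⟩ := exists_minimal_isClosedBoundary (A := A)
  have : shilovBoundary A = S := subset_antisymm (Set.sInter_subset_of_mem hS.1)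
    (Set.subset_sInter fun E hE => subset_of_minimal_isClosedBoundary hS hE)
  exact this ▸ hS.1

theorem shilovBoundary_nonempty [Nontrivial A] : (shilovBoundary A).Nonempty := by
  obtain ⟨m, -⟩ := CharacterSpace.exists_apply_eq_zero (not_isUnit_zero (M₀ := A))
  obtain ⟨t, ht, -⟩ := isClosedBoundary_shilovBoundary.2 (0 : A) m
  exact ⟨t, ht⟩

end WeightedAut

/-! ### Subexponential growth of powers. -/

/-- Gelfand's formula gives the bound with constant 1 for large n; the constant absorbs the
remaining finitely many powers. -/
theorem exists_norm_pow_le_of_spectralRadius_le_one {R : Type*} [NormedRing R] [NormedAlgebra ℂ R]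
    [CompleteSpace R] {a : R} (ha : spectralRadius ℂ a ≤ 1) {r : ℝ} (hr : 1 < r) :
    ∃ C : ℝ, ∀ n : ℕ, ‖a ^ n‖ ≤ C * r ^ n := by
  have hlim := spectrum.pow_norm_pow_one_div_tendsto_nhds_spectralRadius a
  have hev : ∀ᶠ n : ℕ in atTop, ‖a ^ n‖ ≤ r ^ n := by
    have h1 : spectralRadius ℂ a < ENNReal.ofReal r :=
      ha.trans_lt (by simpa using hr)
    filter_upwards [hlim.eventually_lt_const h1, eventually_ge_atTop 1] with n hn hn1
    have hn' := (ENNReal.ofReal_lt_ofReal_iff (by linarith)).mp hn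
    calc ‖a ^ n‖ = (‖a ^ n‖ ^ (1 / n : ℝ)) ^ n := by
          rw [one_div, Real.rpow_inv_natCast_pow (norm_nonneg _) (by omega)]
      _ ≤ r ^ n := by gcongr
  obtain ⟨N, hN⟩ := eventually_atTop.mp hev
  have hsum : 0 ≤ ∑ i ∈ Finset.range N, ‖a ^ i‖ := Finset.sum_nonneg fun _ _ => norm_nonneg _
  refine ⟨1 + ∑ i ∈ Finset.range N, ‖a ^ i‖, fun n => ?_⟩
  have hrn : 1 ≤ r ^ n := one_le_pow₀ hr.le
  rcases le_or_gt N n with h | h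
  · exact (hN n h).trans (le_mul_of_one_le_left (by positivity) (by linarith))
  · have := Finset.single_le_sum (f := fun i => ‖a ^ i‖) (fun _ _ => norm_nonneg _)
      (Finset.mem_range.mpr h)
    nlinarith

theorem exists_norm_zpow_le_of_spectrum_subset_sphere {R : Type*} [NormedRing R]
    [NormedAlgebra ℂ R] [CompleteSpace R] {a : Rˣ}
    (ha : spectrum ℂ (a : R) ⊆ Metric.sphere (0 : ℂ) 1) {r : ℝ} (hr : 1 < r) :
    ∃ C : ℝ, ∀ n : ℤ, ‖((a ^ n : Rˣ) : R)‖ ≤ C * r ^ n.natAbs := by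
  have h1 : spectralRadius ℂ (a : R) ≤ 1 := iSup₂_le fun k hk => by
    have := ha hk
    rw [mem_sphere_zero_iff_norm] at this
    exact_mod_cast this.le
  have h2 : spectralRadius ℂ ((a⁻¹ : Rˣ) : R) ≤ 1 := iSup₂_le fun k hk => by
    have hk0 : k ≠ 0 := by
      rintro rfl
      exact spectrum.zero_notMem ℂ a⁻¹.isUnit hk
    have hk' : k⁻¹ ∈ spectrum ℂ (a : R) := by
      simpa using (spectrum.inv_mem_iff (r := Units.mk0 k hk0) (a := a⁻¹)).mp hk
    have := ha hk'
    rw [mem_sphere_zero_iff_norm, norm_inv, inv_eq_one] at this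
    exact_mod_cast this.le
  obtain ⟨C₁, hC₁⟩ := exists_norm_pow_le_of_spectralRadius_le_one h1 hr
  obtain ⟨C₂, hC₂⟩ := exists_norm_pow_le_of_spectralRadius_le_one h2 hr
  refine ⟨max C₁ C₂, fun n => ?_⟩
  rcases n.eq_nat_or_neg with ⟨m, rfl | rfl⟩
  · rw [zpow_natCast, Int.natAbs_natCast, Units.val_pow_eq_pow_val]
    exact (hC₁ m).trans (by gcongr; exact le_max_left _ _)
  · rw [zpow_neg, zpow_natCast, ← inv_pow, Int.natAbs_neg, Int.natAbs_natCast,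
      Units.val_pow_eq_pow_val]
    exact (hC₂ m).trans (by gcongr; exact le_max_right _ _)

/-- A relation between two groups that is compatible with products in reverse order and with
inverses passes to all integer powers. -/
theorem rel_zpow {G H : Type*} [Group G] [Group H] {P : G → H → Prop} (h1 : P 1 1)
    (hmul : ∀ a b p q, P a p → P b q → P (a * b) (q * p)) (hinv : ∀ a p, P a p → P a⁻¹ p⁻¹)
    {a : G} {p : H} (h : P a p) (n : ℤ) : P (a ^ n) (p ^ n) := by
  induction n with
  | zero => simpa using h1
  | succ i ih =>
    rw [zpow_add_one a, add_comm (i : ℤ) 1, zpow_one_add p]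
    exact hmul _ _ _ _ ih h
  | pred i ih =>
    rw [zpow_sub_one a, sub_eq_neg_add, zpow_add p, zpow_neg_one]
    exact hmul _ _ _ _ ih (hinv _ _ h)

theorem exists_norm_zpow_apply_le_of_spectrum_subset_sphere {E : Type*} [NormedAddCommGroup E]
    [NormedSpace ℂ E] [CompleteSpace E] {τ : (E →L[ℂ] E)ˣ}
    (hτ : spectrum ℂ (τ : E →L[ℂ] E) ⊆ Metric.sphere (0 : ℂ) 1) {r : ℝ} (hr : 1 < r) :
    ∃ C : ℝ, ∀ (n : ℤ) (x : E),
      ‖((τ ^ n : (E →L[ℂ] E)ˣ) : E →L[ℂ] E) x‖ ≤ C * r ^ n.natAbs * ‖x‖ := by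
  obtain ⟨C, hC⟩ := exists_norm_zpow_le_of_spectrum_subset_sphere hτ hr
  exact ⟨C, fun n x => (ContinuousLinearMap.le_opNorm _ _).trans (by gcongr; exact hC n)⟩

theorem units_zpow_add_apply {E : Type*} [TopologicalSpace E] [AddCommMonoid E] [Module ℂ E]
    (τ : (E →L[ℂ] E)ˣ) (m n : ℤ) (x : E) :
    ((τ ^ (m + n) : (E →L[ℂ] E)ˣ) : E →L[ℂ] E) x
      = ((τ ^ m : (E →L[ℂ] E)ˣ) : E →L[ℂ] E) (((τ ^ n : (E →L[ℂ] E)ˣ) : E →L[ℂ] E) x) := by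
  rw [zpow_add, Units.val_mul]
  rfl

theorem units_zpow_apply_recurrence {E : Type*} [TopologicalSpace E] [AddCommGroup E] [Module ℂ E]
    (τ : (E →L[ℂ] E)ˣ) {z : ℂ} {x y : E} (h : z • x - (τ : E →L[ℂ] E) x = y) (n : ℤ) :
    z • ((τ ^ n : (E →L[ℂ] E)ˣ) : E →L[ℂ] E) x - ((τ ^ (n + 1) : (E →L[ℂ] E)ˣ) : E →L[ℂ] E) x
      = ((τ ^ n : (E →L[ℂ] E)ˣ) : E →L[ℂ] E) y := by
  rw [← h, units_zpow_add_apply, zpow_one, map_sub, map_smul]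

/-! ### A point with contractive weights along its orbit. -/

/-- A cocycle over a `ℤ`-action on a compact space that grows subexponentially along each orbit
has an orbit on which it is bounded by its value at the starting point. -/
theorem exists_forall_norm_cocycle_le_one {X : Type*} [TopologicalSpace X] [CompactSpace X]
    [Nonempty X] (ψ : ℤ → X → X) (v : ℤ → X → ℂ) (hv : ∀ n, Continuous (v n))
    (h0 : ∀ s, v 0 s = 1) (hcoc : ∀ m n s, v (m + n) s = v m s * v n (ψ m s))
    (hgrow : ∀ r : ℝ, 1 < r → ∃ C : ℝ, ∀ n s, ‖v n s‖ ≤ C * r ^ n.natAbs) :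
    ∃ t, ∀ n, ‖v n t‖ ≤ 1 := by
  obtain ⟨s⟩ := ‹Nonempty X›
  have hne : ∀ r : ℝ, 1 < r → ∃ t, ∀ n, ‖v n t‖ ≤ r ^ (n.natAbs + 1) := by
    intro r hr
    have hr0 : 0 < r := by linarith
    obtain ⟨C, hC⟩ := hgrow r hr
    set q : ℤ → ℝ := fun m => ‖v m s‖ / r ^ m.natAbs with hq
    have hbdd : BddAbove (Set.range q) := ⟨C, by
      rintro _ ⟨m, rfl⟩
      exact (div_le_iff₀ (by positivity)).mpr (hC m s)⟩
    have hsup : 1 ≤ ⨆ m, q m := by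
      have := le_ciSup hbdd 0
      simpa [hq, h0] using this
    -- Restarting the orbit at a time m that maximizes q up to a factor r bounds all later and
    -- earlier weights; this factor is the +1 in the exponent.
    obtain ⟨m, hm⟩ := exists_lt_of_lt_ciSup
      (show (⨆ m, q m) / r < ⨆ m, q m from div_lt_self (by linarith) hr)
    rw [div_lt_iff₀ hr0] at hm
    have hmpos : 0 < ‖v m s‖ := by
      have : 0 < q m * r := by linarith
      have : 0 < q m := pos_of_mul_pos_left this hr0.le
      exact (div_pos_iff_of_pos_right (by positivity)).mp this
    refine ⟨ψ m s, fun n => ?_⟩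
    have h1 : q (m + n) ≤ q m * r := (le_ciSup hbdd _).trans hm.le
    simp only [hq] at h1
    rw [hcoc, norm_mul, div_le_iff₀ (by positivity)] at h1
    have h2 : r ^ (m + n).natAbs ≤ r ^ m.natAbs * r ^ n.natAbs := by
      rw [← pow_add]
      exact pow_le_pow_right₀ hr.le (Int.natAbs_add_le m n)
    refine le_of_mul_le_mul_left (h1.trans ?_) hmpos
    calc ‖v m s‖ / r ^ m.natAbs * r * r ^ (m + n).natAbs
        ≤ ‖v m s‖ / r ^ m.natAbs * r * (r ^ m.natAbs * r ^ n.natAbs) := by gcongr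
      _ = ‖v m s‖ * r ^ (n.natAbs + 1) := by field_simp; ring
  -- These closed sets decrease as r decreases to 1, so compactness gives a point that works for
  -- every r.
  let K : {r : ℝ // 1 < r} → Set X := fun r => {t | ∀ n, ‖v n t‖ ≤ r.1 ^ (n.natAbs + 1)}
  have hKcl : ∀ r, IsClosed (K r) := fun r => by
    simp only [K, Set.ofPred_forall]
    exact isClosed_iInter fun n => isClosed_le (hv n).norm continuous_const
  have : Nonempty {r : ℝ // 1 < r} := ⟨⟨2, one_lt_two⟩⟩
  have hmono : ∀ a b : {r : ℝ // 1 < r}, a ≤ b → K a ⊆ K b := fun a b hab t ht n =>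
    (ht n).trans (pow_le_pow_left₀ (zero_le_one.trans a.2.le) (show a.1 ≤ b.1 from hab) _)
  obtain ⟨t, ht⟩ := IsCompact.nonempty_iInter_of_directed_nonempty_isCompact_isClosed K
    (fun a b => ⟨min a b, hmono _ _ (min_le_left _ _), hmono _ _ (min_le_right _ _)⟩)
    (fun r => hne r.1 r.2) (fun r => (hKcl r).isCompact) hKcl
  rw [Set.mem_iInter] at ht
  refine ⟨t, fun n => ?_⟩
  have hlim : Tendsto (fun r : ℝ => r ^ (n.natAbs + 1)) (𝓝[>] 1) (𝓝 1) := by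
    have : Continuous fun r : ℝ => r ^ (n.natAbs + 1) := by fun_prop
    simpa using (this.tendsto 1).mono_left nhdsWithin_le_nhds
  refine ge_of_tendsto hlim ?_
  filter_upwards [self_mem_nhdsWithin] with r hr
  exact ht ⟨r, hr⟩ n

/-! ### Weighted composition operators and their integer powers. -/

section WeightedComp

variable {X : Type*} [TopologicalSpace X] [CompactSpace X] {B : Subalgebra ℂ C(X, ℂ)}

/-- The weighted composition operators on `B` with underlying permutation `p` of `X`. -/
def IsWeightedComp (S : B →L[ℂ] B) (p : Equiv.Perm X) : Prop :=
  ∀ (g : B) (s : X), (S g).1 s = (S 1).1 s * g.1 (p s)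

theorem isWeightedComp_one : IsWeightedComp (1 : B →L[ℂ] B) 1 := by
  intro g s
  change g.1 s = 1 * g.1 s
  rw [one_mul]

theorem IsWeightedComp.mul {S T : B →L[ℂ] B}
    {p q : Equiv.Perm X} (hS : IsWeightedComp S p) (hT : IsWeightedComp T q) :
    IsWeightedComp (S * T) (q * p) := by
  intro g s
  change (S (T g)).1 s = (S (T 1)).1 s * g.1 (q (p s))
  rw [hS (T g), hS (T 1), hT g, mul_assoc]

/-- Evaluating S(Tg) = g at s determines Tg at p s, since the case g = 1 shows that the weight S1
has no zero. -/
theorem IsWeightedComp.inv {S T : B →L[ℂ] B}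
    {p : Equiv.Perm X} (hS : IsWeightedComp S p) (hST : S * T = 1) :
    IsWeightedComp T p⁻¹ := by
  have key : ∀ (g : B) s, (S 1).1 s * (T g).1 (p s) = g.1 s := fun g s => by
    rw [← hS (T g)]
    exact congrArg (fun R : B →L[ℂ] B => (R g).1 s) hST
  intro g s
  obtain ⟨s, rfl⟩ := p.surjective s
  rw [show p⁻¹ (p s) = s from p.symm_apply_apply s]
  have h1 : (S 1).1 s * (T 1).1 (p s) = 1 := key 1 s
  have h2 := key g s
  have h0 : (S 1).1 s ≠ 0 := left_ne_zero_of_mul_eq_one h1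
  refine mul_left_cancel₀ h0 ?_
  rw [h2, ← mul_assoc, h1, one_mul]

theorem IsWeightedComp.zpow {τ : (B →L[ℂ] B)ˣ}
    {p : Equiv.Perm X}
    (h : IsWeightedComp (τ : B →L[ℂ] B) p) (n : ℤ) :
    IsWeightedComp ((τ ^ n : (B →L[ℂ] B)ˣ) : B →L[ℂ] B)
      (p ^ n) :=
  rel_zpow (P := fun (σ : (B →L[ℂ] B)ˣ) p =>
      IsWeightedComp (σ : B →L[ℂ] B) p) isWeightedComp_one
    (fun _ _ _ _ h₁ h₂ => h₁.mul h₂) (fun σ _ h₁ => h₁.inv σ.mul_inv) h n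

theorem norm_apply_le (g : B) (s : X) : ‖g.1 s‖ ≤ ‖g‖ :=
  g.1.norm_coe_le_norm s

/-- On the orbit of a suitable point of `X` all powers of the operator are contractive. -/
theorem exists_forall_norm_zpow_apply_le [Nonempty X] [CompleteSpace B]
    {τ : (B →L[ℂ] B)ˣ} {p : Equiv.Perm X}
    (h : IsWeightedComp (τ : B →L[ℂ] B) p)
    (hspec : spectrum ℂ (τ : B →L[ℂ] B) ⊆ Metric.sphere (0 : ℂ) 1) :
    ∃ t : X, ∀ (n : ℤ) (g : B),
      ‖(((τ ^ n : (B →L[ℂ] B)ˣ) : B →L[ℂ] B) g).1 t‖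
        ≤ ‖g.1 ((p ^ n) t)‖ := by
  let v : ℤ → X → ℂ := fun n s => (((τ ^ n : (B →L[ℂ] B)ˣ) : B →L[ℂ] B) 1).1 s
  have hcoc : ∀ (m n : ℤ) (s : X), v (m + n) s = v m s * v n ((p ^ m : Equiv.Perm X) s) := by
    intro m n s
    have h1 := h.zpow m (((τ ^ n : (B →L[ℂ] B)ˣ) : B →L[ℂ] B) 1) s
    rw [← units_zpow_add_apply τ m n 1] at h1
    exact h1
  have hv0 : ∀ s, v 0 s = 1 := fun s => by
    simp only [v, zpow_zero τ]
    rfl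
  obtain ⟨t, ht⟩ := exists_forall_norm_cocycle_le_one (fun n s => (p ^ n : Equiv.Perm X) s) v
    (fun n => ContinuousMap.continuous _) hv0 hcoc
    (fun r hr => by
      obtain ⟨C, hC⟩ := exists_norm_zpow_apply_le_of_spectrum_subset_sphere hspec hr
      exact ⟨C * ‖(1 : B)‖, fun n s =>
        (norm_apply_le _ s).trans ((hC n 1).trans_eq (mul_right_comm _ _ _))⟩)
  refine ⟨t, fun n g => ?_⟩
  rw [h.zpow n, norm_mul]
  exact mul_le_of_le_one_left (norm_nonneg _) (ht n)

end WeightedComp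

/-! ### Orbits on ∂A and approximate indicators of a peak point. -/

namespace WeightedAut
variable {A : Type*} [NormedCommRing A] [NormedAlgebra ℂ A] [CompleteSpace A]

instance : CompleteSpace (checkAlg A) :=
  (Subalgebra.isClosed_topologicalClosure _).completeSpace_coe

/-- The homeomorphism of the Shilov boundary induced by an automorphism, as a permutation. -/
def boundaryPerm (U : A ≃ₐ[ℂ] A) : Equiv.Perm (shilovBoundary A) where
  toFun := phiBoundary U
  invFun := phiBoundary U.symm
  left_inv t := Subtype.ext ((phi U).left_inv t)
  right_inv t := Subtype.ext ((phi U).right_inv t)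

theorem coe_boundaryPerm_pow (U : A ≃ₐ[ℂ] A) (n : ℕ) (t : shilovBoundary A) :
    (((boundaryPerm U ^ n) t : shilovBoundary A) : characterSpace ℂ A) = (phi U)^[n] t := by
  induction n with
  | zero => rfl
  | succ k ih =>
    rw [pow_succ', Equiv.Perm.mul_apply, Function.iterate_succ_apply', ← ih]
    rfl

theorem boundaryPerm_zpow_ne (U : A ≃ₐ[ℂ] A) {t : shilovBoundary A}
    (ht : (t : characterSpace ℂ A) ∉ Function.periodicPts (phi U)) {n : ℤ} (hn : n ≠ 0) :
    (boundaryPerm U ^ n) t ≠ t := by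
  intro h
  have h' : (boundaryPerm U ^ n.natAbs) t = t := by
    rcases n.natAbs_eq with e | e
    · rw [e, zpow_natCast] at h
      exact h
    · rw [e, zpow_neg, zpow_natCast, Equiv.Perm.inv_eq_iff_eq] at h
      exact h.symm
  refine ht (Function.mk_mem_periodicPts (Int.natAbs_pos.mpr hn) ?_)
  rw [Function.IsPeriodicPt, Function.IsFixedPt, ← coe_boundaryPerm_pow, h']

theorem isWeightedComp_checkOp (U : A ≃ₐ[ℂ] A) (w : A) :
    IsWeightedComp (checkOp U w) (boundaryPerm U) := by
  intro g s
  rw [checkOp_apply, checkOp_apply]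
  change check A w s * g.1 (phiBoundary U s) = check A w s * 1 * g.1 (phiBoundary U s)
  rw [mul_one]

theorem exists_seq_check_tendsto_indicator {t : shilovBoundary A}
    (ht : IsPeakPoint (checkAlg A) t) :
    ∃ f : ℕ → A, (∀ k s, ‖check A (f k) s‖ ≤ 2) ∧
      Tendsto (fun k => check A (f k) t) atTop (𝓝 1) ∧
      ∀ s, s ≠ t → Tendsto (fun k => check A (f k) s) atTop (𝓝 0) := by
  obtain ⟨g, hg, hgt, hgs⟩ := ht
  -- The peak function lies only in the closure Ǎ, so its powers are replaced by nearby transforms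
  -- of elements of A.
  have happrox : ∀ k : ℕ, ∃ f : A, dist (g ^ k) (check A f) < 1 / (k + 1) := fun k => by
    have hmem : g ^ k ∈ closure ((check A).range : Set C(shilovBoundary A, ℂ)) :=
      (checkAlg A).pow_mem hg k
    obtain ⟨_, ⟨f, rfl⟩, hf⟩ := Metric.mem_closure_iff.mp hmem (1 / (k + 1)) (by positivity)
    exact ⟨f, hf⟩
  choose f hf using happrox
  have hdist : ∀ k s, ‖check A (f k) s - g s ^ k‖ ≤ 1 / (k + 1) := fun k s => by
    rw [← dist_eq_norm, dist_comm]
    exact (ContinuousMap.dist_apply_le_dist s).trans (hf k).le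
  have hlim : ∀ s, Tendsto (fun k => check A (f k) s - g s ^ k) atTop (𝓝 0) := fun s =>
    squeeze_zero_norm (fun k => hdist k s) tendsto_one_div_add_atTop_nhds_zero_nat
  refine ⟨f, fun k s => ?_, ?_, fun s hs => ?_⟩
  · have h1 : ‖g s‖ ≤ 1 := by
      rcases eq_or_ne s t with rfl | hs
      · rw [hgt, norm_one]
      · exact (hgs s hs).le
    have h2 : ‖g s ^ k‖ ≤ 1 := by rw [norm_pow]; exact pow_le_one₀ (norm_nonneg _) h1
    have h3 : (1 : ℝ) / (k + 1) ≤ 1 := by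
      rw [div_le_one (by positivity)]; linarith [(Nat.cast_nonneg k : (0 : ℝ) ≤ k)]
    calc ‖check A (f k) s‖ = ‖(check A (f k) s - g s ^ k) + g s ^ k‖ := by rw [sub_add_cancel]
      _ ≤ 1 + 1 := (norm_add_le _ _).trans (add_le_add ((hdist k s).trans h3) h2)
      _ = 2 := by norm_num
  · simpa [hgt] using (hlim t).add_const 1
  · simpa using (hlim s).add (tendsto_pow_atTop_nhds_zero_of_norm_lt_one (hgs s hs))

end WeightedAut

/-- Used to turn the geometric factor 1 / (1 − e^(−|re u|)) into a multiple of 1 / |re u|. -/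
theorem le_two_mul_one_sub_exp_neg {x : ℝ} (h0 : 0 ≤ x) (h1 : x ≤ 1) :
    x ≤ 2 * (1 - Real.exp (-x)) := by
  have h2 : Real.exp (-x) ≤ (1 + x)⁻¹ := by
    rw [Real.exp_neg]
    exact inv_anti₀ (by linarith) (by linarith [Real.add_one_le_exp x])
  have h3 : (1 + x)⁻¹ ≤ 1 - x / 2 := by
    rw [inv_le_iff_one_le_mul₀ (by linarith)]
    nlinarith
  linarith

/-! ### The resolvent along an orbit, and the contradiction. -/

namespace WeightedAut
variable {A : Type*} [NormedCommRing A] [NormedAlgebra ℂ A] [CompleteSpace A]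

/-- The Gelfand transform on `∂A` as an element of `Ǎ`. -/
def toCheckAlg (f : A) : checkAlg A :=
  ⟨check A f, Subalgebra.le_topologicalClosure _ ⟨f, rfl⟩⟩

theorem zpow_checkOp_recurrence {U : A ≃ₐ[ℂ] A} {w : A} {τ : (checkAlg A →L[ℂ] checkAlg A)ˣ}
    (hτ : (τ : checkAlg A →L[ℂ] checkAlg A) = checkOp U w) {h f : A} {z : ℂ}
    (hhf : z • h - w * U h = f) (t : shilovBoundary A) (n : ℤ) :
    z * (((τ ^ n : (checkAlg A →L[ℂ] checkAlg A)ˣ) : checkAlg A →L[ℂ] checkAlg A)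
        (toCheckAlg h)).1 t
      - (((τ ^ (n + 1) : (checkAlg A →L[ℂ] checkAlg A)ˣ) : checkAlg A →L[ℂ] checkAlg A)
        (toCheckAlg h)).1 t
      = (((τ ^ n : (checkAlg A →L[ℂ] checkAlg A)ˣ) : checkAlg A →L[ℂ] checkAlg A)
        (toCheckAlg f)).1 t := by
  refine congrArg (fun g : checkAlg A => g.1 t) (units_zpow_apply_recurrence τ ?_ n)
  rw [hτ]
  refine Subtype.ext ?_
  change z • check A h - compOpC U w (check A h) = check A f
  rw [compOpC_check, ← map_smul, ← map_sub, hhf]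

/-- Along the orbit of a suitable point of `∂A` there are contractive functionals, starting with
the evaluation at that point, which the operator `f ↦ w · U f` shifts. -/
theorem exists_orbit_functionals [Nonempty (shilovBoundary A)] {U : A ≃ₐ[ℂ] A} {w : A}
    (hspec : spectrum ℂ (checkOp U w) ⊆ Metric.sphere (0 : ℂ) 1) :
    ∃ (t : shilovBoundary A) (Φ : ℤ → A → ℂ), (∀ h, Φ 0 h = check A h t) ∧
      (∀ n h, ‖Φ n h‖ ≤ ‖check A h ((boundaryPerm U ^ n) t)‖) ∧
      ∀ (z : ℂ) (h f : A), z • h - w * U h = f → ∀ n, z * Φ n h - Φ (n + 1) h = Φ n f := by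
  -- Zero is not on the unit circle, so negative powers are available.
  obtain ⟨τ, hτ⟩ : IsUnit (checkOp U w) :=
    spectrum.isUnit_of_zero_notMem ℂ fun h0 => by simpa using hspec h0
  have hcomp : IsWeightedComp (τ : checkAlg A →L[ℂ] checkAlg A) (boundaryPerm U) :=
    hτ ▸ isWeightedComp_checkOp U w
  obtain ⟨t, ht⟩ := exists_forall_norm_zpow_apply_le hcomp (hτ ▸ hspec)
  exact ⟨t, fun n h =>
    (((τ ^ n : (checkAlg A →L[ℂ] checkAlg A)ˣ) : checkAlg A →L[ℂ] checkAlg A)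
      (toCheckAlg h)).1 t, fun h => rfl, fun n h => ht n (toCheckAlg h),
    fun z h f hhf n => zpow_checkOp_recurrence hτ hhf t n⟩

theorem differentiableAt_character_resolvent {T : A →L[ℂ] A} {z : ℂ} (hz : z ∈ resolventSet ℂ T)
    (F : characterSpace ℂ A) (f : A) :
    DifferentiableAt ℂ (fun ζ => F (resolvent T ζ f)) z := by
  let ℓ : (A →L[ℂ] A) →L[ℂ] ℂ :=
    (CharacterSpace.toCLM F).comp (ContinuousLinearMap.apply ℂ A f)
  exact ℓ.differentiableAt.comp z
    (spectrum.hasDerivAt_resolvent_const_left hz).differentiableAt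

theorem smul_resolvent_sub_apply {T : A →L[ℂ] A} {z : ℂ} (hz : z ∈ resolventSet ℂ T) (f : A) :
    z • resolvent T z f - T (resolvent T z f) = f := by
  have : (algebraMap ℂ (A →L[ℂ] A) z - T) * resolvent T z = 1 := Ring.mul_inverse_cancel _ hz
  exact congrArg (fun S : A →L[ℂ] A => S f) this

theorem sphere_subset_spectrum_weightedOp (hss : Ring.jacobson A = ⊥) (U : A ≃ₐ[ℂ] A) (w : A)
    (hU : ∀ n : ℕ, 1 ≤ n → U ^ n ≠ 1)
    (hspec : spectrum ℂ (checkOp U w) ⊆ Metric.sphere (0 : ℂ) 1)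
    (hper : ∀ t ∈ shilovBoundary A,
      t ∉ Function.periodicPts (phi U))
    (hpeak : ∀ t : shilovBoundary A, IsPeakPoint (checkAlg A) t) :
    Metric.sphere (0 : ℂ) 1 ⊆ spectrum ℂ (weightedOp hss U w) := by
  -- On the zero algebra U would be the identity, against `hU` with n = 1.
  have hA : Nontrivial A := by
    by_contra hA
    rw [not_nontrivial_iff_subsingleton] at hA
    exact hU 1 le_rfl (AlgEquiv.ext fun x => Subsingleton.elim _ _)
  have hne : Nonempty (shilovBoundary A) := shilovBoundary_nonempty.to_subtype
  obtain ⟨t, Φ, hΦ0, hΦ, hΦrec⟩ := exists_orbit_functionals hspec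
  obtain ⟨f, hf2, hft, hfs⟩ := exists_seq_check_tendsto_indicator (hpeak t)
  intro lam hlam
  rw [mem_sphere_zero_iff_norm] at hlam
  by_contra hnot
  set T := weightedOp hss U w with hT
  have hopen : IsOpen {u : ℂ | lam * Complex.exp u ∈ resolventSet ℂ T} :=
    (spectrum.isOpen_resolventSet T).preimage (by fun_prop)
  have h0mem : (0 : ℂ) ∈ {u : ℂ | lam * Complex.exp u ∈ resolventSet ℂ T} := by
    simpa [spectrum.mem_iff, spectrum.mem_resolventSet_iff] using hnot
  obtain ⟨ε, hε, hball⟩ := Metric.isOpen_iff.mp hopen 0 h0mem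
  -- The bound 1 serves `le_two_mul_one_sub_exp_neg`; ε / 3 keeps |re u| + |im u| ≤ 2d below ε.
  set d : ℝ := min 1 (ε / 3) with hd
  have hd0 : 0 < d := by positivity
  have hd1 : d ≤ 1 := min_le_left _ _
  have hres : ∀ u ∈ Set.Icc (-d) d ×ℂ Set.Icc (-d) d, lam * Complex.exp u ∈ resolventSet ℂ T := by
    intro u hu
    refine hball ?_
    rw [mem_ball_zero_iff]
    have h1 := abs_le.mpr (Complex.mem_reProdIm.mp hu).1
    have h2 := abs_le.mpr (Complex.mem_reProdIm.mp hu).2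
    have h3 : d ≤ ε / 3 := min_le_right _ _
    linarith [Complex.norm_le_abs_re_add_abs_im u]
  let a : ℕ → ℂ → ℤ → ℂ := fun k z n => Φ n (resolvent T z (f k))
  let c : ℕ → ℤ → ℂ := fun k n => Φ n (f k)
  have hc : ∀ k n, ‖c k n‖ ≤ 2 := fun k n => (hΦ n _).trans (hf2 k _)
  -- Uniformity in n suffices, to kill the remainders; the estimates uniform in k come from c alone.
  have ha : ∀ k z n, ‖a k z n‖ ≤ ‖check A (resolvent T z (f k))‖ := fun k z n =>
    (hΦ n _).trans (ContinuousMap.norm_coe_le_norm _ _)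
  have hrec : ∀ k z, z ∈ resolventSet ℂ T → ∀ n, z * a k z n - a k z (n + 1) = c k n :=
    fun k z hz => hΦrec z _ _ (smul_resolvent_sub_apply hz (f k))
  have hclim : ∀ n, Tendsto (fun k => c k n) atTop (𝓝 (if n = 0 then 1 else 0)) := by
    intro n
    split_ifs with hn
    · subst hn
      exact hft.congr fun k => (hΦ0 (f k)).symm
    · have := (hfs _ (boundaryPerm_zpow_ne U (hper t t.2) hn)).norm
      rw [norm_zero] at this
      exact squeeze_zero_norm (fun k => hΦ n _) this
  have hnorm : ∀ u : ℂ, ‖lam * Complex.exp u‖ = Real.exp u.re := fun u => by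
    rw [norm_mul, hlam, one_mul, Complex.norm_exp]
  have hfwd : ∀ k, ∀ u ∈ Set.Icc (-d) d ×ℂ Set.Icc (-d) d, 0 < u.re →
      HasSum (fun n : ℕ => (lam * Complex.exp u)⁻¹ ^ n * c k n)
        (lam * Complex.exp u * a k (lam * Complex.exp u) 0) := fun k u hu hpos =>
    hasSum_forward_of_recurrence (by rw [hnorm]; exact Real.one_lt_exp_iff.mpr hpos)
      (ha k _) (hc k) (hrec k _ (hres u hu))
  have hbwd : ∀ k, ∀ u ∈ Set.Icc (-d) d ×ℂ Set.Icc (-d) d, u.re < 0 →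
      HasSum (fun n : ℕ => -((lam * Complex.exp u) ^ (n + 1) * c k (-(n + 1))))
        (lam * Complex.exp u * a k (lam * Complex.exp u) 0) := fun k u hu hneg =>
    hasSum_backward_of_recurrence (by rw [hnorm]; exact Real.exp_lt_one_iff.mpr hneg)
      (ha k _) (hc k) (hrec k _ (hres u hu))
  -- The constant is 2 · 2: the bound on c times the factor from `le_two_mul_one_sub_exp_neg`.
  refine not_tendsto_indicator_re_pos (M := 4) hd0
    (fun k u => lam * Complex.exp u * a k (lam * Complex.exp u) 0) ?_ ?_ ?_ ?_
  · intro k u hu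
    have h1 : DifferentiableAt ℂ (fun u : ℂ => lam * Complex.exp u) u := by fun_prop
    have h2 : DifferentiableAt ℂ (fun z => a k z 0) (lam * Complex.exp u) := by
      simp only [a, hΦ0]
      exact differentiableAt_character_resolvent (hres u hu) t (f k)
    exact (h1.mul (h2.comp u h1)).differentiableWithinAt
  · intro k u hu hu0
    have hre := abs_le.mpr (Complex.mem_reProdIm.mp hu).1
    rcases hu0.lt_or_gt with h | h
    · have key := norm_le_of_hasSum_backward (by rw [hnorm]; exact Real.exp_lt_one_iff.mpr h) (hc k)
        (hbwd k u hu h)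
      rw [abs_of_neg h] at hre ⊢
      have h2 := le_two_mul_one_sub_exp_neg (x := -u.re) (by linarith) (by linarith)
      rw [hnorm] at key
      rw [neg_neg] at h2
      have hlt : Real.exp u.re < 1 := Real.exp_lt_one_iff.mpr h
      have h3 : 0 < 1 - Real.exp u.re := by linarith
      calc _ ≤ Real.exp u.re * (1 - Real.exp u.re)⁻¹ * 2 * (2 * (1 - Real.exp u.re)) := by
            gcongr; linarith
        _ = 4 * Real.exp u.re := by field_simp; ring
        _ ≤ 4 := by linarith
    · have key := norm_le_of_hasSum_forward (by rw [hnorm]; exact Real.one_lt_exp_iff.mpr h) (hc k)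
        (hfwd k u hu h)
      rw [abs_of_pos h] at hre ⊢
      have h2 := le_two_mul_one_sub_exp_neg (x := u.re) (by linarith) (by linarith)
      rw [hnorm, ← Real.exp_neg] at key
      have h3 : 0 < 1 - Real.exp (-u.re) := by linarith
      calc _ ≤ (1 - Real.exp (-u.re))⁻¹ * 2 * (2 * (1 - Real.exp (-u.re))) := by gcongr
        _ = 4 := by field_simp; ring
  · intro u hu h
    exact tendsto_one_of_hasSum_forward (by rw [hnorm]; exact Real.one_lt_exp_iff.mpr h) hc
      (fun k => hfwd k u hu h) hclim
  · intro u hu h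
    exact tendsto_zero_of_hasSum_backward (by rw [hnorm]; exact Real.exp_lt_one_iff.mpr h) hc
      (fun k => hbwd k u hu h) hclim

end WeightedAut

end

theorem theorem3 {A : Type*} [NormedCommRing A] [NormedAlgebra ℂ A] [CompleteSpace A]
    (hss : Ring.jacobson A = ⊥) (U : A ≃ₐ[ℂ] A) (w : A)
    (hU : ∀ n : ℕ, 1 ≤ n → U ^ n ≠ 1)
    (hspec : spectrum ℂ (WeightedAut.checkOp U w) ⊆ Metric.sphere (0 : ℂ) 1)
    (hper : ∀ t ∈ WeightedAut.shilovBoundary A,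
      t ∉ Function.periodicPts (WeightedAut.phi U))
    (hpeak : ∀ t : WeightedAut.shilovBoundary A, IsPeakPoint (WeightedAut.checkAlg A) t) :
    Metric.sphere (0 : ℂ) 1 ⊆ spectrum ℂ (WeightedAut.weightedOp hss U w) :=
  WeightedAut.sphere_subset_spectrum_weightedOp hss U w hU hspec hper hpeak
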